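/- Let $n\ge 2$, let $\mathbb{B}^n$ and $\mathbb{S}^{n-1}$ be the open unit ball and the unit sphere of $\mathbb{R}^n$, and let $\sigma$ be the normalized surface measure on $\mathbb{S}^{n-1}$ (so $\sigma(\mathbb{S}^{n-1})=1$). For $\phi\in L^\infty(\mathbb{S}^{n-1},\mathbb{R})$ let $$\mathcal{P}_h[\phi](x)=\int_{\mathbb{S}^{n-1}}\left(\frac{1-|x|^2}{|x-\zeta|^2}\right)^{n-1}\phi(\zeta)\,d\sigma(\zeta),\qquad x\in\mathbb{B}^n,$$ be its invariant Poisson integral. Then, for every $x\in\mathbb{B}^n$ and every $\phi\in L^\infty(\mathbb{S}^{n-1},\mathbb{R})$, the function $u=\mathcal{P}_h[\phi]$ is differentiable at $x$ and $$|\nabla u(x)|\le \frac{2(n-1)\,\Gamma(\frac n2)}{\sqrt{\pi}\,\Gamma(\frac{n+1}{2})}\,\frac{1}{1-|x|^2}\,\|\phi\|_\infty .$$ This is sharp at every point: for each $x\in\mathbb{B}^n$, the number $$\frac{2(n-1)\,\Gamma(\frac n2)}{\sqrt{\pi}\,\Gamma(\frac{n+1}{2})}\,\frac{1}{1-|x|^2}$$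 is the least constant $C$ such that $|\nabla \mathcal{P}_h[\phi](x)|\le C\|\phi\|_\infty$ for all $\phi\in L^\infty(\mathbb{S}^{n-1},\mathbb{R})$. Moreover, for each $x\in\mathbb{B}^n$ and each $\ell\in\mathbb{S}^{n-1}$, the least constant $\mathcal{C}_\infty(x;\ell)$ such that $|\langle\nabla \mathcal{P}_h[\phi](x),\ell\rangle|\le \mathcal{C}_\infty(x;\ell)\|\phi\|_\infty$ for all $\phi\in L^\infty(\mathbb{S}^{n-1},\mathbb{R})$ equals this same number. -/

import Mathlib

open MeasureTheory Metric
open scoped ENNReal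

/-- The rotation-invariant surface measure on the unit sphere of `ℝⁿ`, normalized to have total
mass one. -/
noncomputable def sphereMeasure (n : ℕ) :
    Measure (sphere (0 : EuclideanSpace ℝ (Fin n)) 1) :=
  ((volume : Measure (EuclideanSpace ℝ (Fin n))).toSphere Set.univ)⁻¹ •
    (volume : Measure (EuclideanSpace ℝ (Fin n))).toSphere

/-- The hyperbolic Poisson kernel `((1 - |x|²) / |x - ζ|²) ^ (n - 1)`. -/
noncomputable def hyperbolicPoissonKernel (n : ℕ) (x ζ : EuclideanSpace ℝ (Fin n)) : ℝ :=
  ((1 - ‖x‖ ^ 2) / ‖x - ζ‖ ^ 2) ^ (n - 1)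

/-- The invariant Poisson integral of a function on the unit sphere. -/
noncomputable def hyperbolicPoisson (n : ℕ)
    (φ : sphere (0 : EuclideanSpace ℝ (Fin n)) 1 → ℝ) (x : EuclideanSpace ℝ (Fin n)) : ℝ :=
  ∫ ζ, hyperbolicPoissonKernel n x ζ * φ ζ ∂(sphereMeasure n)

/-- `C` is the optimal number `C_p(x)`: the least constant such that
`|∇u(x)| ≤ C ‖φ‖_p` for all `φ ∈ L^p`, where `u` is the invariant Poisson integral of `φ`. -/
def IsOptimalGradientConstant (n : ℕ) (p : ℝ≥0∞) (x : EuclideanSpace ℝ (Fin n)) (C : ℝ) : Prop :=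
  IsLeast {c : ℝ | ∀ φ : Lp ℝ p (sphereMeasure n),
    ‖gradient (hyperbolicPoisson n φ) x‖ ≤ c * ‖φ‖} C

/-- `C` is the optimal number `C_p(x; ℓ)`: the least constant such that
`|⟨∇u(x), ℓ⟩| ≤ C ‖φ‖_p` for all `φ ∈ L^p`, where `u` is the invariant Poisson integral of `φ`. -/
def IsOptimalDirectionalConstant (n : ℕ) (p : ℝ≥0∞) (x ℓ : EuclideanSpace ℝ (Fin n))
    (C : ℝ) : Prop :=
  IsLeast {c : ℝ | ∀ φ : Lp ℝ p (sphereMeasure n),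
    |inner ℝ (gradient (hyperbolicPoisson n φ) x) ℓ| ≤ c * ‖φ‖} C

/-- The number `2 (n - 1) Γ(n/2) / (√π Γ((n+1)/2)) · 1 / (1 - |x|²)`. -/
noncomputable def hyperbolicGradientBound (n : ℕ) (x : EuclideanSpace ℝ (Fin n)) : ℝ :=
  2 * ((n : ℝ) - 1) * Real.Gamma ((n : ℝ) / 2) /
    (Real.sqrt Real.pi * Real.Gamma (((n : ℝ) + 1) / 2)) * (1 / (1 - ‖x‖ ^ 2))

/-! Write `G` for `lightConeBoost x`. On the unit sphere the Poisson kernel is `‖G ζ‖⁻¹ ^ (n - 1)`,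
and its gradient in `x` is `2 (n - 1) / (1 - ‖x‖²)` times the kernel times the unit vector `G ζ / ‖G
ζ‖`. The kernel is also the Jacobian of `ζ ↦ G ζ / ‖G ζ‖` on the sphere
(`lintegral_toSphere_lightConeBoost`). Hence the `L¹` norm of `⟨∇ₓ K, ℓ⟩` is `2 (n - 1) / (1 -
‖x‖²)` times the mean of `|⟨ω, ℓ⟩|` over the sphere, which depends neither on `x` nor on the unit
vector `ℓ`.

By `L¹`–`L^∞` duality this norm is the best directional constant, attained at a sign function. As it
is the same for all `ℓ`, it is the best constant for the full gradient too. The mean, computed with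
a Gaussian, supplies the Gamma factors. -/

/-! ### Lorentz boosts of the light cone -/

section Boost

variable {E : Type*} [NormedAddCommGroup E] [InnerProductSpace ℝ E]

/-- The spatial part of the Lorentz boost of the light cone `{(‖y‖, y)}` that corresponds to the
point `x` of the unit ball. -/
noncomputable def lightConeBoost (x y : E) : E :=
  y - (2 / (1 - ‖x‖ ^ 2) * (‖y‖ - inner ℝ x y)) • x

lemma one_sub_norm_sq_pos {E : Type*} [NormedAddCommGroup E] {x : E} (hx : ‖x‖ < 1) :
    0 < 1 - ‖x‖ ^ 2 := by
  nlinarith [norm_nonneg x]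

/-- The right side is the time component of the boosted null vector `(‖y‖, y)`; since a boost
preserves the cone, it equals the norm of the spatial part. -/
lemma norm_lightConeBoost {x : E} (hx : ‖x‖ < 1) (y : E) :
    ‖lightConeBoost x y‖ = ‖y‖ + 2 / (1 - ‖x‖ ^ 2) * (‖x‖ ^ 2 * ‖y‖ - inner ℝ x y) := by
  have h := one_sub_norm_sq_pos hx
  have hxy := real_inner_le_norm x y
  have hn : 0 ≤ ‖y‖ + 2 / (1 - ‖x‖ ^ 2) * (‖x‖ ^ 2 * ‖y‖ - inner ℝ x y) := by
    have : ‖y‖ + 2 / (1 - ‖x‖ ^ 2) * (‖x‖ ^ 2 * ‖y‖ - inner ℝ x y) =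
        ((1 - ‖x‖) ^ 2 * ‖y‖ + 2 * (‖x‖ * ‖y‖ - inner ℝ x y)) / (1 - ‖x‖ ^ 2) := by
      field_simp
      ring
    rw [this]
    have : 0 ≤ ‖x‖ * ‖y‖ - inner ℝ x y := by linarith
    positivity
  rw [← sq_eq_sq₀ (norm_nonneg _) hn, lightConeBoost, norm_sub_sq_real, norm_smul, inner_smul_right,
    real_inner_comm, mul_pow, Real.norm_eq_abs, sq_abs]
  field_simp
  ring

lemma lightConeBoost_neg_lightConeBoost {x : E} (hx : ‖x‖ < 1) (y : E) :
    lightConeBoost (-x) (lightConeBoost x y) = y := by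
  have h := one_sub_norm_sq_pos hx
  rw [lightConeBoost, norm_lightConeBoost hx, lightConeBoost, norm_neg, inner_neg_left,
    inner_sub_right, inner_smul_right, real_inner_self_eq_norm_sq, smul_neg, sub_neg_eq_add,
    sub_add, ← sub_smul, sub_eq_self]
  convert zero_smul ℝ x
  field_simp
  ring

lemma lightConeBoost_injective {x : E} (hx : ‖x‖ < 1) : Function.Injective (lightConeBoost x) :=
  Function.LeftInverse.injective (lightConeBoost_neg_lightConeBoost hx)

@[simp]
lemma lightConeBoost_zero (x : E) : lightConeBoost x 0 = 0 := by simp [lightConeBoost]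

lemma lightConeBoost_smul (x y : E) {r : ℝ} (hr : 0 ≤ r) :
    lightConeBoost x (r • y) = r • lightConeBoost x y := by
  simp only [lightConeBoost, norm_smul, Real.norm_eq_abs, abs_of_nonneg hr, inner_smul_right,
    smul_sub, smul_smul]
  congr 2
  ring

lemma lightConeBoost_ne_zero {x : E} (hx : ‖x‖ < 1) {y : E} (hy : y ≠ 0) :
    lightConeBoost x y ≠ 0 := fun h ↦
  hy (lightConeBoost_injective hx (h.trans (lightConeBoost_zero x).symm))

lemma image_lightConeBoost_compl_zero {x : E} (hx : ‖x‖ < 1) :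
    lightConeBoost x '' {0}ᶜ = {0}ᶜ := by
  ext z
  constructor
  · rintro ⟨y, hy, rfl⟩
    exact lightConeBoost_ne_zero hx hy
  · intro hz
    have hx' : ‖-x‖ < 1 := by rwa [norm_neg]
    refine ⟨lightConeBoost (-x) z, lightConeBoost_ne_zero hx' hz, ?_⟩
    simpa using lightConeBoost_neg_lightConeBoost hx' z

@[fun_prop]
lemma continuous_lightConeBoost (x : E) : Continuous (lightConeBoost x) := by
  unfold lightConeBoost
  fun_prop

lemma hasFDerivAt_norm_of_ne_zero {y : E} (hy : y ≠ 0) :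
    HasFDerivAt (fun z : E ↦ ‖z‖) (innerSL ℝ (‖y‖⁻¹ • y)) y := by
  have h := (hasStrictFDerivAt_norm_sq y).hasFDerivAt.sqrt
    (by positivity : ‖y‖ ^ 2 ≠ 0)
  simp only [Real.sqrt_sq (norm_nonneg _)] at h
  convert h using 1
  ext v
  simp
  field_simp

lemma hasFDerivAt_lightConeBoost (x : E) {y : E} (hy : y ≠ 0) :
    HasFDerivAt (lightConeBoost x) (ContinuousLinearMap.id ℝ E -
      (2 / (1 - ‖x‖ ^ 2)) • (innerSL ℝ (‖y‖⁻¹ • y - x)).smulRight x) y := by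
  have h := (((hasFDerivAt_norm_of_ne_zero hy).sub
    (innerSL ℝ x).hasFDerivAt).const_mul (2 / (1 - ‖x‖ ^ 2))).smul_const x
  refine ((hasFDerivAt_id y).sub h).congr_fderiv ?_
  ext v
  simp [smul_smul]

/-- The derivative is a rank-one perturbation of the identity. The value expresses the Lorentz
invariance of the measure `dy / ‖y‖` on the light cone. -/
lemma det_fderiv_lightConeBoost [FiniteDimensional ℝ E] {x : E} (hx : ‖x‖ < 1)
    {y : E} (hy : y ≠ 0) :
    (ContinuousLinearMap.id ℝ E -
      (2 / (1 - ‖x‖ ^ 2)) • (innerSL ℝ (‖y‖⁻¹ • y - x)).smulRight x).det =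
      ‖lightConeBoost x y‖ / ‖y‖ := by
  have h := one_sub_norm_sq_pos hx
  have hy' : ‖y‖ ≠ 0 := by simpa
  have : ((ContinuousLinearMap.id ℝ E -
      (2 / (1 - ‖x‖ ^ 2)) • (innerSL ℝ (‖y‖⁻¹ • y - x)).smulRight x : E →L[ℝ] E) : E →ₗ[ℝ] E) =
      LinearMap.transvection (-(2 / (1 - ‖x‖ ^ 2)) • (innerSL ℝ (‖y‖⁻¹ • y - x) : E →ₗ[ℝ] ℝ)) x := by
    ext v
    have (a b : ℝ) (w : E) : w - (a * b) • x = w + (-a * b) • x := by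
      rw [neg_mul, neg_smul, sub_eq_add_neg]
    simpa [LinearMap.transvection, smul_smul] using this _ _ v
  rw [ContinuousLinearMap.det, this, LinearMap.transvection.det, norm_lightConeBoost hx]
  simp [real_inner_comm]
  field_simp
  ring

end Boost

/-! ### Polar coordinates -/

section Polar

variable {E : Type*} [NormedAddCommGroup E] [NormedSpace ℝ E] [FiniteDimensional ℝ E]
  [Nontrivial E] [MeasurableSpace E] [BorelSpace E] (μ : Measure E) [μ.IsAddHaarMeasure]

lemma lintegral_eq_lintegral_toSphere {F : E → ℝ≥0∞} (hF : Measurable F) :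
    ∫⁻ y, F y ∂μ = ∫⁻ ζ, ∫⁻ r, F (r.1 • ζ.1)
      ∂(Measure.volumeIoiPow (Module.finrank ℝ E - 1)) ∂μ.toSphere := by
  conv_lhs => rw [← restrict_compl_singleton (μ := μ) 0]
  rw [← lintegral_subtype_comap (measurableSet_singleton (0 : E)).compl F,
    ← lintegral_prod (fun p : sphere (0 : E) 1 × Set.Ioi (0 : ℝ) ↦ F (p.2.1 • p.1.1))
      (by fun_prop),
    ← μ.measurePreserving_homeomorphUnitSphereProd.lintegral_comp (by fun_prop)]
  refine lintegral_congr fun y ↦ ?_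
  have : ‖y.1‖ ≠ 0 := norm_ne_zero_iff.2 y.2
  simp [smul_smul, this]

lemma lintegral_volumeIoiPow_indicator (m : ℕ) {a : ℝ} (ha : 0 < a) (c : ℝ≥0∞) :
    ∫⁻ r, (Set.Iio a).indicator (fun _ ↦ c) r.1 ∂(Measure.volumeIoiPow m) =
      c * ENNReal.ofReal (a ^ (m + 1) / (m + 1)) := by
  rw [← Measure.volumeIoiPow_apply_Iio m ⟨a, ha⟩, ← lintegral_indicator_const measurableSet_Iio]
  rfl

end Polar

/-! ### The Jacobian of a boost on the sphere -/

section Invariance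

variable {E : Type*} [NormedAddCommGroup E] [InnerProductSpace ℝ E] [FiniteDimensional ℝ E]
  [Nontrivial E] [MeasurableSpace E] [BorelSpace E] (μ : Measure E) [μ.IsAddHaarMeasure]

/-- The conformal action of a Lorentz boost on the sphere has Jacobian `‖G ζ‖ ^ (1 - dim E)`. -/
lemma lintegral_toSphere_lightConeBoost {x : E} (hx : ‖x‖ < 1) {f : E → ℝ≥0∞}
    (hf : Measurable f) :
    ∫⁻ ζ, f (‖lightConeBoost x ζ.1‖⁻¹ • lightConeBoost x ζ.1) *
      ENNReal.ofReal (‖lightConeBoost x ζ.1‖⁻¹ ^ (Module.finrank ℝ E - 1)) ∂μ.toSphere =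
      ∫⁻ ζ, f ζ.1 ∂μ.toSphere := by
  set d := Module.finrank ℝ E - 1 with hd
  -- `f` is extended radially and cut off at the unit ball, so that a change of variables in `E`,
  -- read in polar coordinates, yields the one on the sphere.
  set H : E → ℝ≥0∞ := fun z ↦ (Set.Iio 1).indicator (fun _ ↦ f (‖z‖⁻¹ • z)) ‖z‖ with hH
  have hHm : Measurable H := by
    have : H = {z : E | ‖z‖ < 1}.indicator (fun z ↦ f (‖z‖⁻¹ • z)) := by
      ext z; simp [hH, Set.indicator]
    rw [this]
    exact Measurable.indicator (by fun_prop) (measurableSet_lt (by fun_prop) (by fun_prop))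
  have hS : MeasurableSet ({0}ᶜ : Set E) := (measurableSet_singleton 0).compl
  have key : ∫⁻ y, H y ∂μ = ∫⁻ y, ENNReal.ofReal (‖lightConeBoost x y‖ / ‖y‖) *
      H (lightConeBoost x y) ∂μ := by
    rw [← restrict_compl_singleton (μ := μ) 0]
    nth_rw 1 [← image_lightConeBoost_compl_zero hx]
    rw [lintegral_image_eq_lintegral_abs_det_fderiv_mul μ hS
      (fun y hy ↦ (hasFDerivAt_lightConeBoost x hy).hasFDerivWithinAt)
      (lightConeBoost_injective hx).injOn]
    refine setLIntegral_congr_fun hS fun y hy ↦ ?_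
    rw [det_fderiv_lightConeBoost hx hy, abs_of_nonneg (by positivity)]
  rw [lintegral_eq_lintegral_toSphere μ hHm, lintegral_eq_lintegral_toSphere μ (by fun_prop)] at key
  have e1 : ∀ ζ : sphere (0 : E) 1, ∫⁻ r, H (r.1 • ζ.1) ∂(Measure.volumeIoiPow d) =
      f ζ.1 * ENNReal.ofReal (1 ^ (d + 1) / (d + 1)) := by
    intro ζ
    rw [← lintegral_volumeIoiPow_indicator d one_pos]
    refine lintegral_congr fun r ↦ ?_
    have hr : 0 < r.1 := r.2
    simp [hH, norm_smul, abs_of_pos hr, smul_smul, hr.ne']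
  have e2 : ∀ ζ : sphere (0 : E) 1, ∫⁻ r, ENNReal.ofReal (‖lightConeBoost x (r.1 • ζ.1)‖ /
      ‖r.1 • ζ.1‖) * H (lightConeBoost x (r.1 • ζ.1)) ∂(Measure.volumeIoiPow d) =
      f (‖lightConeBoost x ζ.1‖⁻¹ • lightConeBoost x ζ.1) *
      ENNReal.ofReal (‖lightConeBoost x ζ.1‖⁻¹ ^ d) *
        ENNReal.ofReal (1 ^ (d + 1) / (d + 1)) := by
    intro ζ
    have hζ : ζ.1 ≠ 0 := ne_zero_of_mem_unit_sphere ζ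
    have hG : 0 < ‖lightConeBoost x ζ.1‖ := norm_pos_iff.2 (lightConeBoost_ne_zero hx hζ)
    set ρ := ‖lightConeBoost x ζ.1‖ with hρ
    -- On the ray through `ζ` the cutoff becomes `r < ρ⁻¹`: the radial integral gives `ρ⁻¹ ^ (d + 1)
    -- / (d + 1)`, and the determinant `ρ` cancels one power.
    have : ENNReal.ofReal (ρ⁻¹ ^ d) * ENNReal.ofReal (1 ^ (d + 1) / (d + 1)) =
        ENNReal.ofReal ρ * ENNReal.ofReal (ρ⁻¹ ^ (d + 1) / (d + 1)) := by
      rw [← ENNReal.ofReal_mul (by positivity), ← ENNReal.ofReal_mul (by positivity)]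
      congr 1
      rw [pow_succ]
      linear_combination (-(ρ⁻¹ ^ d / ((d : ℝ) + 1))) * mul_inv_cancel₀ hG.ne'
    rw [mul_assoc, this, mul_left_comm, ← lintegral_volumeIoiPow_indicator d (inv_pos.2 hG),
      ← lintegral_const_mul']
    · refine lintegral_congr fun r ↦ ?_
      have hr : 0 < r.1 := r.2
      rw [lightConeBoost_smul x _ hr.le]
      have h1 : r.1 * ρ < 1 ↔ r.1 < ρ⁻¹ := by rw [← one_div, lt_div_iff₀ hG]
      have h3 : ‖ζ.1‖ = 1 := norm_eq_of_mem_sphere ζ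
      have h4 : r.1 * ρ / (r.1 * 1) = ρ := by field_simp
      have h2 : (r.1 * ρ)⁻¹ * r.1 = ρ⁻¹ := by field_simp
      simp only [hH, norm_smul, Real.norm_eq_abs, abs_of_pos hr, ← hρ, smul_smul, h2,
        Set.indicator, Set.mem_Iio, h1, h3, h4]
    · exact ENNReal.ofReal_ne_top
  simp only [← hd] at key
  rw [lintegral_congr e1, lintegral_congr e2] at key
  have hc0 : ENNReal.ofReal (1 ^ (d + 1) / (d + 1)) ≠ 0 := by
    rw [Ne, ENNReal.ofReal_eq_zero, not_le]
    positivity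
  rw [lintegral_mul_const' _ _ ENNReal.ofReal_ne_top,
    lintegral_mul_const' _ _ ENNReal.ofReal_ne_top] at key
  exact ((ENNReal.mul_left_inj hc0 ENNReal.ofReal_ne_top).1 key).symm

end Invariance

/-! ### Gaussian moments and the mean of `|⟨ζ, l⟩|` -/

lemma lintegral_volumeIoiPow_pow_mul_exp_neg_sq (p m : ℕ) :
    ∫⁻ r, ENNReal.ofReal (r.1 ^ p * Real.exp (-r.1 ^ 2)) ∂(Measure.volumeIoiPow m) =
      ENNReal.ofReal (Real.Gamma (((m + p : ℕ) + 1) / 2) / 2) := by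
  have hq : (-1 : ℝ) < (m + p : ℕ) := by
    have : (0 : ℝ) ≤ (m + p : ℕ) := Nat.cast_nonneg _
    linarith
  have hval := integral_rpow_mul_exp_neg_rpow (p := 2) two_pos hq
  have hint := integrableOn_rpow_mul_exp_neg_rpow (p := 2) hq two_pos
  rw [Measure.volumeIoiPow, lintegral_withDensity_eq_lintegral_mul₀ (by fun_prop) (by fun_prop)]
  have : ∀ r : Set.Ioi (0 : ℝ), ((fun r : Set.Ioi (0 : ℝ) ↦ ENNReal.ofReal (r.1 ^ m)) *
      fun r : Set.Ioi (0 : ℝ) ↦ ENNReal.ofReal (r.1 ^ p * Real.exp (-r.1 ^ 2))) r =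
      ENNReal.ofReal (r.1 ^ ((m + p : ℕ) : ℝ) * Real.exp (-r.1 ^ (2 : ℝ))) := by
    intro r
    have hr : 0 < r.1 := r.2
    rw [Pi.mul_apply, ← ENNReal.ofReal_mul (by positivity), Real.rpow_natCast, pow_add,
      mul_assoc, Real.rpow_two]
  rw [lintegral_congr this, lintegral_subtype_comap measurableSet_Ioi
    fun r : ℝ ↦ ENNReal.ofReal (r ^ ((m + p : ℕ) : ℝ) * Real.exp (-r ^ (2 : ℝ))),
    ← ofReal_integral_eq_lintegral_ofReal hint, hval]
  · congr 1
    ring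
  · filter_upwards [ae_restrict_mem measurableSet_Ioi] with r hr
    have : 0 < r := hr
    positivity

lemma integral_abs_mul_exp_neg_sq : ∫ t : ℝ, |t| * Real.exp (-t ^ 2) = 1 := by
  have h := integral_comp_abs (f := fun t : ℝ ↦ t * Real.exp (-t ^ 2))
  simp only [sq_abs] at h
  have hval := integral_rpow_mul_exp_neg_rpow (p := 2) (q := 1) two_pos (by norm_num)
  norm_num at hval
  rw [h, hval]
  norm_num

lemma integrable_abs_mul_exp_neg_sq : Integrable fun t : ℝ ↦ |t| * Real.exp (-t ^ 2) := by
  -- A non-integrable function would have Bochner integral `0`, not `1`.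
  by_contra h
  have := integral_undef h
  rw [integral_abs_mul_exp_neg_sq] at this
  exact one_ne_zero this

section

variable {n : ℕ}

lemma integral_exp_neg_sq : ∫ t : ℝ, Real.exp (-t ^ 2) = √Real.pi := by
  simpa using integral_gaussian 1

lemma integrable_exp_neg_sq : Integrable fun t : ℝ ↦ Real.exp (-t ^ 2) := by
  simpa using integrable_exp_neg_mul_sq one_pos

lemma exp_neg_norm_sq_eq_prod (y : Fin n → ℝ) :
    Real.exp (-‖WithLp.toLp 2 y‖ ^ 2) = ∏ i, Real.exp (-y i ^ 2) := by
  rw [EuclideanSpace.norm_sq_eq, ← Real.exp_sum]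
  simp

lemma lintegral_exp_neg_norm_sq :
    ∫⁻ y : EuclideanSpace ℝ (Fin n), ENNReal.ofReal (Real.exp (-‖y‖ ^ 2)) =
      ENNReal.ofReal (√Real.pi ^ n) := by
  rw [← (PiLp.volume_preserving_toLp (Fin n)).lintegral_comp (by fun_prop)]
  simp only [exp_neg_norm_sq_eq_prod]
  rw [← ofReal_integral_eq_lintegral_ofReal, integral_fintype_prod_volume_eq_pow
    fun t : ℝ ↦ Real.exp (-t ^ 2), integral_exp_neg_sq, Fintype.card_fin]
  · exact Integrable.fintype_prod fun _ ↦ integrable_exp_neg_sq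
  · exact .of_forall fun _ ↦ by positivity

lemma lintegral_abs_apply_mul_exp_neg_norm_sq (i₀ : Fin n) :
    ∫⁻ y : EuclideanSpace ℝ (Fin n), ENNReal.ofReal (|y i₀| * Real.exp (-‖y‖ ^ 2)) =
      ENNReal.ofReal (√Real.pi ^ (n - 1)) := by
  rw [← (PiLp.volume_preserving_toLp (Fin n)).lintegral_comp (by fun_prop)]
  have h : ∀ y : Fin n → ℝ, |(WithLp.toLp 2 y) i₀| * Real.exp (-‖WithLp.toLp 2 y‖ ^ 2) =
      ∏ i, (if i = i₀ then |y i| else 1) * Real.exp (-y i ^ 2) := by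
    intro y
    rw [exp_neg_norm_sq_eq_prod, Finset.prod_mul_distrib]
    simp
  simp only [h]
  rw [← ofReal_integral_eq_lintegral_ofReal, integral_fintype_prod_volume_eq_prod
    fun (i : Fin n) (t : ℝ) ↦ (if i = i₀ then |t| else 1) * Real.exp (-t ^ 2)]
  · have : ∀ i : Fin n, ∫ t : ℝ, (if i = i₀ then |t| else 1) * Real.exp (-t ^ 2) =
        if i = i₀ then 1 else √Real.pi := by
      intro i
      split_ifs
      · exact integral_abs_mul_exp_neg_sq
      · simpa using integral_exp_neg_sq
    simp only [this, Finset.prod_ite, Finset.prod_const, one_pow, one_mul]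
    rw [Finset.filter_ne' , Finset.card_erase_of_mem (Finset.mem_univ _), Finset.card_univ,
      Fintype.card_fin]
  · refine Integrable.fintype_prod (f := fun (i : Fin n) (t : ℝ) ↦
      (if i = i₀ then |t| else 1) * Real.exp (-t ^ 2)) fun i ↦ ?_
    dsimp only
    split_ifs
    · exact integrable_abs_mul_exp_neg_sq
    · simpa using integrable_exp_neg_sq
  · refine .of_forall fun _ ↦ Finset.prod_nonneg fun i _ ↦ mul_nonneg ?_ (by positivity)
    split_ifs <;> positivity

lemma lintegral_abs_inner_mul_exp_neg_norm_sq {l : EuclideanSpace ℝ (Fin n)} (hl : ‖l‖ = 1) :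
    ∫⁻ y : EuclideanSpace ℝ (Fin n), ENNReal.ofReal (|inner ℝ y l| * Real.exp (-‖y‖ ^ 2)) =
      ENNReal.ofReal (√Real.pi ^ (n - 1)) := by
  have hn : n ≠ 0 := by
    rintro rfl
    simp [Subsingleton.elim l 0] at hl
  let i₀ : Fin n := ⟨0, Nat.pos_of_ne_zero hn⟩
  -- Completing `l` to an orthonormal basis reduces to a coordinate function, by rotation
  -- invariance.
  have ho : Orthonormal ℝ (({i₀} : Set (Fin n)).domRestrict fun _ ↦ l) :=
    ⟨fun _ ↦ hl, fun i j hij ↦ (hij (Subsingleton.elim i j)).elim⟩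
  obtain ⟨b, hb⟩ := ho.exists_orthonormalBasis_extension_of_card_eq (by simp)
  have hb' : b i₀ = l := hb i₀ rfl
  rw [← lintegral_abs_apply_mul_exp_neg_norm_sq i₀]
  conv_rhs => rw [← b.measurePreserving_repr.lintegral_comp (by fun_prop)]
  refine lintegral_congr fun y ↦ ?_
  rw [b.repr_apply_apply, hb', real_inner_comm, LinearIsometryEquiv.norm_map]

/-- The mean of `|⟨ζ, l⟩|` over the unit sphere, for a unit vector `l`. -/
lemma lintegral_abs_inner_sphereMeasure {l : EuclideanSpace ℝ (Fin n)} (hl : ‖l‖ = 1) :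
    ∫⁻ ζ, ENNReal.ofReal |inner ℝ ζ.1 l| ∂(sphereMeasure n) =
      ENNReal.ofReal (Real.Gamma (n / 2) / (√Real.pi * Real.Gamma ((n + 1) / 2))) := by
  obtain ⟨m, rfl⟩ : ∃ m, n = m + 1 := by
    refine Nat.exists_eq_succ_of_ne_zero ?_
    rintro rfl
    simp [Subsingleton.elim l 0] at hl
  set μ := (volume : Measure (EuclideanSpace ℝ (Fin (m + 1))))
  -- Polar coordinates factor both Gaussian integrals into a spherical and a radial part; the
  -- quotient of the spherical parts is the mean.
  have h0 := lintegral_exp_neg_norm_sq (n := m + 1)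
  have h1 := lintegral_abs_inner_mul_exp_neg_norm_sq hl
  rw [lintegral_eq_lintegral_toSphere _ (by fun_prop), finrank_euclideanSpace_fin,
    Nat.add_sub_cancel] at h0 h1
  have e0 : ∀ ζ : sphere (0 : EuclideanSpace ℝ (Fin (m + 1))) 1,
      ∫⁻ r, ENNReal.ofReal (Real.exp (-‖r.1 • ζ.1‖ ^ 2)) ∂(Measure.volumeIoiPow m) =
      ENNReal.ofReal (Real.Gamma (((m + 0 : ℕ) + 1) / 2) / 2) := by
    intro ζ
    rw [← lintegral_volumeIoiPow_pow_mul_exp_neg_sq]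
    refine lintegral_congr fun r ↦ ?_
    simp [norm_smul]
  have e1 : ∀ ζ : sphere (0 : EuclideanSpace ℝ (Fin (m + 1))) 1,
      ∫⁻ r, ENNReal.ofReal (|inner ℝ (r.1 • ζ.1) l| * Real.exp (-‖r.1 • ζ.1‖ ^ 2))
        ∂(Measure.volumeIoiPow m) = ENNReal.ofReal |inner ℝ ζ.1 l| *
      ENNReal.ofReal (Real.Gamma (((m + 1 : ℕ) + 1) / 2) / 2) := by
    intro ζ
    rw [← lintegral_volumeIoiPow_pow_mul_exp_neg_sq, ← lintegral_const_mul' _ _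
      ENNReal.ofReal_ne_top]
    refine lintegral_congr fun r ↦ ?_
    have hr : 0 < r.1 := r.2
    rw [← ENNReal.ofReal_mul (abs_nonneg _), mul_left_comm, ← mul_assoc]
    simp [norm_smul, inner_smul_left, abs_mul, abs_of_pos hr]
  rw [lintegral_congr e0, lintegral_const] at h0
  rw [lintegral_congr e1, lintegral_mul_const' _ _ ENNReal.ofReal_ne_top] at h1
  have hΓ0 : 0 < Real.Gamma (((m : ℝ) + 1) / 2) := Real.Gamma_pos_of_pos (by positivity)
  have hΓ1 : 0 < Real.Gamma (((m : ℝ) + 1 + 1) / 2) := Real.Gamma_pos_of_pos (by positivity)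
  push_cast at h0 h1 ⊢
  rw [add_zero] at h0
  have hπ : 0 < √Real.pi := Real.sqrt_pos.2 Real.pi_pos
  have k0 : μ.toSphere Set.univ = ENNReal.ofReal (√Real.pi ^ (m + 1) /
      (Real.Gamma (((m : ℝ) + 1) / 2) / 2)) := by
    rw [ENNReal.ofReal_div_of_pos (by positivity), ← h0, mul_comm, ENNReal.mul_div_cancel_right]
    · simpa using hΓ0
    · exact ENNReal.ofReal_ne_top
  have k1 : ∫⁻ ζ, ENNReal.ofReal |inner ℝ ζ.1 l| ∂μ.toSphere = ENNReal.ofReal (√Real.pi ^ m /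
      (Real.Gamma (((m : ℝ) + 1 + 1) / 2) / 2)) := by
    rw [ENNReal.ofReal_div_of_pos (by positivity), ← h1, ENNReal.mul_div_cancel_right]
    · simpa using hΓ1
    · exact ENNReal.ofReal_ne_top
  rw [sphereMeasure, lintegral_smul_measure, k1, k0, ← ENNReal.ofReal_inv_of_pos (by positivity),
    smul_eq_mul, ← ENNReal.ofReal_mul (by positivity)]
  congr 1
  field_simp
  ring

end

/-! ### The Poisson kernel and its gradient -/

section Kernel

variable {n : ℕ}

lemma norm_lightConeBoost_of_norm_eq_one {x ζ : EuclideanSpace ℝ (Fin n)} (hx : ‖x‖ < 1)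
    (hζ : ‖ζ‖ = 1) : ‖lightConeBoost x ζ‖ = ‖x - ζ‖ ^ 2 / (1 - ‖x‖ ^ 2) := by
  have h := one_sub_norm_sq_pos hx
  rw [norm_lightConeBoost hx, norm_sub_sq_real, hζ]
  field_simp
  ring

lemma hyperbolicPoissonKernel_eq {x ζ : EuclideanSpace ℝ (Fin n)} (hx : ‖x‖ < 1)
    (hζ : ‖ζ‖ = 1) : hyperbolicPoissonKernel n x ζ = ‖lightConeBoost x ζ‖⁻¹ ^ (n - 1) := by
  rw [norm_lightConeBoost_of_norm_eq_one hx hζ, inv_div, hyperbolicPoissonKernel]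

/-- The gradient in `x` of the hyperbolic Poisson kernel, for `ζ` on the unit sphere. -/
noncomputable def hyperbolicPoissonKernelGradient (n : ℕ) (x ζ : EuclideanSpace ℝ (Fin n)) :
    EuclideanSpace ℝ (Fin n) :=
  (2 * ((n - 1 : ℕ) : ℝ) / (1 - ‖x‖ ^ 2) * ‖lightConeBoost x ζ‖⁻¹ ^ (n - 1)) •
    (‖lightConeBoost x ζ‖⁻¹ • lightConeBoost x ζ)

@[fun_prop]
lemma measurable_hyperbolicPoissonKernelGradient (x : EuclideanSpace ℝ (Fin n)) :
    Measurable (hyperbolicPoissonKernelGradient n x) := by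
  unfold hyperbolicPoissonKernelGradient
  fun_prop

lemma aestronglyMeasurable_hyperbolicPoissonKernelGradient (x : EuclideanSpace ℝ (Fin n)) :
    AEStronglyMeasurable (fun ζ : sphere (0 : EuclideanSpace ℝ (Fin n)) 1 ↦
      hyperbolicPoissonKernelGradient n x ζ.1) (sphereMeasure n) :=
  Measurable.aestronglyMeasurable (by fun_prop)

lemma aestronglyMeasurable_hyperbolicPoissonKernel (x : EuclideanSpace ℝ (Fin n)) :
    AEStronglyMeasurable (fun ζ : sphere (0 : EuclideanSpace ℝ (Fin n)) 1 ↦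
      hyperbolicPoissonKernel n x ζ.1) (sphereMeasure n) := by
  unfold hyperbolicPoissonKernel
  exact Measurable.aestronglyMeasurable (by fun_prop)

/-- Uniformity over the ball of radius `s` supplies the dominating constants for differentiation
under the integral. -/
lemma inv_norm_lightConeBoost_le {x ζ : EuclideanSpace ℝ (Fin n)} {s : ℝ} (hs : s < 1)
    (hx : ‖x‖ ≤ s) (hζ : ‖ζ‖ = 1) : ‖lightConeBoost x ζ‖⁻¹ ≤ ((1 - s) ^ 2)⁻¹ := by
  have hx1 : ‖x‖ < 1 := hx.trans_lt hs
  have h1 : 1 - s ≤ ‖x - ζ‖ := by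
    have := norm_sub_norm_le ζ x
    rw [norm_sub_rev] at this
    linarith
  have h2 : 0 < 1 - s := by linarith
  rw [norm_lightConeBoost_of_norm_eq_one hx1 hζ, inv_div, ← one_div]
  gcongr
  nlinarith [norm_nonneg x]

lemma norm_hyperbolicPoissonKernelGradient_le {x ζ : EuclideanSpace ℝ (Fin n)} {s : ℝ}
    (hs : s < 1) (hx : ‖x‖ ≤ s) (hζ : ‖ζ‖ = 1) :
    ‖hyperbolicPoissonKernelGradient n x ζ‖ ≤
      2 * ((n - 1 : ℕ) : ℝ) / (1 - s ^ 2) * ((1 - s) ^ 2)⁻¹ ^ (n - 1) := by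
  have hx1 : ‖x‖ < 1 := hx.trans_lt hs
  have h := one_sub_norm_sq_pos hx1
  have hG : ‖lightConeBoost x ζ‖ ≠ 0 := norm_ne_zero_iff.2
    (lightConeBoost_ne_zero hx1 (norm_ne_zero_iff.1 (by rw [hζ]; exact one_ne_zero)))
  have hs0 : 0 ≤ s := (norm_nonneg x).trans hx
  have hs2 : 0 < 1 - s ^ 2 := by nlinarith
  rw [hyperbolicPoissonKernelGradient, norm_smul, norm_smul, norm_inv, norm_norm,
    inv_mul_cancel₀ hG, mul_one, Real.norm_of_nonneg (by positivity)]
  refine mul_le_mul ?_ (pow_le_pow_left₀ (by positivity)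
    (inv_norm_lightConeBoost_le hs hx hζ) _) (by positivity) (by positivity)
  gcongr

lemma hasFDerivAt_hyperbolicPoissonKernel {x ζ : EuclideanSpace ℝ (Fin n)} (hx : ‖x‖ < 1)
    (hζ : ‖ζ‖ = 1) : HasFDerivAt (fun y ↦ hyperbolicPoissonKernel n y ζ)
      (innerSL ℝ (hyperbolicPoissonKernelGradient n x ζ)) x := by
  have h := one_sub_norm_sq_pos hx
  have hxζ : x - ζ ≠ 0 := by
    rw [sub_ne_zero]
    rintro rfl
    exact hx.ne hζ
  have hd : 0 < ‖x - ζ‖ ^ 2 := by positivity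
  have h1 : HasFDerivAt (fun y : EuclideanSpace ℝ (Fin n) ↦ 1 - ‖y‖ ^ 2)
      (-(2 • innerSL ℝ x)) x := (hasStrictFDerivAt_norm_sq x).hasFDerivAt.const_sub 1
  have h2 : HasFDerivAt (fun y : EuclideanSpace ℝ (Fin n) ↦ ‖y - ζ‖ ^ 2)
      (2 • innerSL ℝ (x - ζ)) x := by
    simpa using ((hasFDerivAt_id x).sub_const ζ).norm_sq
  have h3 := h1.fun_mul ((hasDerivAt_inv hd.ne').comp_hasFDerivAt x h2)
  simp only [Function.comp_def, ← div_eq_mul_inv] at h3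
  refine ((hasDerivAt_pow (n - 1) _).comp_hasFDerivAt x h3).congr_fderiv ?_
  rw [hyperbolicPoissonKernelGradient, norm_lightConeBoost_of_norm_eq_one hx hζ, inv_div]
  generalize n - 1 = m
  -- Differentiating the power produces the truncated exponent `m - 1`, so `m = 0` is separate.
  rcases m with _ | m
  · ext v
    simp
  ext v
  have hsum : ‖x - ζ‖ ^ 2 + (1 - ‖x‖ ^ 2) = 2 - 2 * inner ℝ x ζ := by
    rw [norm_sub_sq_real, hζ]
    ring
  -- Eliminating `⟨x, ζ⟩` leaves a rational identity in `‖x - ζ‖` and `1 - ‖x‖²`.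
  have hq : inner ℝ x ζ = 1 - (‖x - ζ‖ ^ 2 + (1 - ‖x‖ ^ 2)) / 2 := by linarith
  simp only [lightConeBoost, hζ, hq]
  simp
  generalize inner ℝ x v = p
  generalize inner ℝ ζ v = q
  generalize hA : 1 - ‖x‖ ^ 2 = A at *
  generalize ‖x - ζ‖ = D at *
  have hD : D ≠ 0 := by rintro rfl; simp at hd
  rw [pow_succ _ m]
  generalize (A / D ^ 2) ^ m = Q
  field_simp
  ring

end Kernel

/-! ### The gradient of the Poisson integral and sharpness -/

section Gradient

variable {n : ℕ}

instance isFiniteMeasure_sphereMeasure : IsFiniteMeasure (sphereMeasure n) := by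
  refine ⟨lt_of_le_of_lt ?_ ENNReal.one_lt_top⟩
  rw [sphereMeasure, Measure.smul_apply, smul_eq_mul]
  exact ENNReal.inv_mul_le_one _

lemma integrable_smul_hyperbolicPoissonKernelGradient {x : EuclideanSpace ℝ (Fin n)}
    (hx : ‖x‖ < 1) {φ : sphere (0 : EuclideanSpace ℝ (Fin n)) 1 → ℝ} {C : ℝ}
    (hφ : AEStronglyMeasurable φ (sphereMeasure n))
    (hC : ∀ᵐ ζ ∂(sphereMeasure n), ‖φ ζ‖ ≤ C) :
    Integrable (fun ζ ↦ φ ζ • hyperbolicPoissonKernelGradient n x ζ.1) (sphereMeasure n) := by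
  refine .of_bound (hφ.smul (aestronglyMeasurable_hyperbolicPoissonKernelGradient x)) (C * (2 * ((n - 1 : ℕ) : ℝ) / (1 - ‖x‖ ^ 2) *
    ((1 - ‖x‖) ^ 2)⁻¹ ^ (n - 1))) ?_
  filter_upwards [hC] with ζ hζ
  rw [norm_smul]
  exact mul_le_mul hζ (norm_hyperbolicPoissonKernelGradient_le hx le_rfl
    (norm_eq_of_mem_sphere ζ)) (norm_nonneg _) ((norm_nonneg _).trans hζ)

/-- Differentiation of the invariant Poisson integral under the integral sign. -/
lemma hasGradientAt_hyperbolicPoisson {x : EuclideanSpace ℝ (Fin n)} (hx : ‖x‖ < 1)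
    {φ : sphere (0 : EuclideanSpace ℝ (Fin n)) 1 → ℝ} {C : ℝ}
    (hφ : AEStronglyMeasurable φ (sphereMeasure n))
    (hC : ∀ᵐ ζ ∂(sphereMeasure n), ‖φ ζ‖ ≤ C) :
    HasGradientAt (hyperbolicPoisson n φ)
      (∫ ζ, φ ζ • hyperbolicPoissonKernelGradient n x ζ.1 ∂(sphereMeasure n)) x := by
  obtain ⟨s, hxs, hs⟩ := exists_between hx
  have hs2 : ball (0 : EuclideanSpace ℝ (Fin n)) s ∈ nhds x :=
    isOpen_ball.mem_nhds (by simpa using hxs)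
  have hint := integrable_smul_hyperbolicPoissonKernelGradient hx hφ hC
  have key := hasFDerivAt_integral_of_dominated_of_fderiv_le (𝕜 := ℝ) (μ := sphereMeasure n)
    (F := fun y ζ ↦ hyperbolicPoissonKernel n y ζ.1 * φ ζ)
    (F' := fun y ζ ↦ φ ζ • innerSL ℝ (hyperbolicPoissonKernelGradient n y ζ.1))
    (x₀ := x) (s := ball 0 s)
    (bound := fun _ ↦ C * (2 * ((n - 1 : ℕ) : ℝ) / (1 - s ^ 2) * ((1 - s) ^ 2)⁻¹ ^ (n - 1)))
    hs2 (.of_forall fun y ↦ (aestronglyMeasurable_hyperbolicPoissonKernel _).mul hφ) ?_ ?_ ?_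
    (integrable_const _) ?_
  · rw [hasGradientAt_iff_hasFDerivAt]
    refine key.congr_fderiv ?_
    ext v
    have hint' : Integrable (fun ζ : sphere (0 : EuclideanSpace ℝ (Fin n)) 1 ↦
        φ ζ • innerSL ℝ (hyperbolicPoissonKernelGradient n x ζ.1)) (sphereMeasure n) := by
      refine hint.congr' ?_ (.of_forall fun ζ ↦ ?_)
      · exact hφ.smul ((innerSL ℝ).continuous.comp_aestronglyMeasurable
          (aestronglyMeasurable_hyperbolicPoissonKernelGradient x))
      · rw [norm_smul, norm_smul, innerSL_apply_norm]
    rw [ContinuousLinearMap.integral_apply hint', InnerProductSpace.toDual_apply_apply,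
      real_inner_comm, ← integral_inner hint]
    refine integral_congr_ae (.of_forall fun ζ ↦ ?_)
    simp [inner_smul_right, real_inner_comm]
  · refine .of_bound ((aestronglyMeasurable_hyperbolicPoissonKernel _).mul hφ)
      (((1 - s) ^ 2)⁻¹ ^ (n - 1) * C) ?_
    filter_upwards [hC] with ζ hζ
    have h1 : ‖ζ.1‖ = 1 := norm_eq_of_mem_sphere ζ
    have h2 : (0 : ℝ) ≤ ((1 - s) ^ 2)⁻¹ := by positivity
    rw [norm_mul, hyperbolicPoissonKernel_eq hx h1, Real.norm_of_nonneg (by positivity)]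
    exact mul_le_mul (pow_le_pow_left₀ (by positivity)
      (inv_norm_lightConeBoost_le hs hxs.le h1) _) hζ (norm_nonneg _) (by positivity)
  · exact hφ.smul ((innerSL ℝ).continuous.comp_aestronglyMeasurable
          (aestronglyMeasurable_hyperbolicPoissonKernelGradient x))
  · filter_upwards [hC] with ζ hζ y hy
    rw [norm_smul, innerSL_apply_norm]
    exact mul_le_mul hζ (norm_hyperbolicPoissonKernelGradient_le hs
      (by simpa using (mem_ball.1 hy).le) (norm_eq_of_mem_sphere ζ)) (norm_nonneg _)
      ((norm_nonneg _).trans hζ)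
  · refine .of_forall fun ζ y hy ↦ ?_
    have hy1 : ‖y‖ < 1 := by
      have := mem_ball_zero_iff.1 hy
      linarith
    exact (hasFDerivAt_hyperbolicPoissonKernel hy1 (norm_eq_of_mem_sphere ζ)).mul_const (φ ζ)

lemma ae_norm_le_norm_Lp_top (φ : Lp ℝ ∞ (sphereMeasure n)) :
    ∀ᵐ ζ ∂(sphereMeasure n), ‖φ ζ‖ ≤ ‖φ‖ := by
  have := ae_le_lpNorm_exponent_top (Lp.memLp φ)
  rwa [← toReal_eLpNorm (Lp.aestronglyMeasurable φ)] at this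

lemma inner_gradient_hyperbolicPoisson {x : EuclideanSpace ℝ (Fin n)} (hx : ‖x‖ < 1)
    (φ : Lp ℝ ∞ (sphereMeasure n)) (l : EuclideanSpace ℝ (Fin n)) :
    inner ℝ (gradient (hyperbolicPoisson n φ) x) l =
      ∫ ζ, φ ζ * inner ℝ (hyperbolicPoissonKernelGradient n x ζ.1) l ∂(sphereMeasure n) := by
  have hm := Lp.aestronglyMeasurable φ
  have hC := ae_norm_le_norm_Lp_top φ
  rw [(hasGradientAt_hyperbolicPoisson hx hm hC).gradient, real_inner_comm,
    ← integral_inner (integrable_smul_hyperbolicPoissonKernelGradient hx hm hC)]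
  refine integral_congr_ae (.of_forall fun ζ ↦ ?_)
  simp [inner_smul_right, real_inner_comm]

/-- The kernel factor in the gradient is exactly the Jacobian, so substituting `ω = G ζ / ‖G ζ‖`
removes the boost. -/
lemma lintegral_abs_inner_hyperbolicPoissonKernelGradient {x l : EuclideanSpace ℝ (Fin n)}
    (hx : ‖x‖ < 1) (hl : ‖l‖ = 1) :
    ∫⁻ ζ, ENNReal.ofReal |inner ℝ (hyperbolicPoissonKernelGradient n x ζ.1) l|
      ∂(sphereMeasure n) = ENNReal.ofReal (hyperbolicGradientBound n x) := by
  obtain ⟨m, rfl⟩ : ∃ m, n = m + 1 := by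
    refine Nat.exists_eq_succ_of_ne_zero ?_
    rintro rfl
    simp [Subsingleton.elim l 0] at hl
  have h := one_sub_norm_sq_pos hx
  have inv := lintegral_toSphere_lightConeBoost
    (volume : Measure (EuclideanSpace ℝ (Fin (m + 1)))) hx
    (f := fun y ↦ ENNReal.ofReal |inner ℝ y l|) (by fun_prop)
  rw [finrank_euclideanSpace_fin, Nat.add_sub_cancel] at inv
  have hpt : ∀ ζ : sphere (0 : EuclideanSpace ℝ (Fin (m + 1))) 1,
      ENNReal.ofReal |inner ℝ (hyperbolicPoissonKernelGradient (m + 1) x ζ.1) l| =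
      ENNReal.ofReal (2 * (m : ℝ) / (1 - ‖x‖ ^ 2)) *
      (ENNReal.ofReal |inner ℝ (‖lightConeBoost x ζ.1‖⁻¹ • lightConeBoost x ζ.1) l| *
        ENNReal.ofReal (‖lightConeBoost x ζ.1‖⁻¹ ^ m)) := by
    intro ζ
    rw [← ENNReal.ofReal_mul (abs_nonneg _), ← ENNReal.ofReal_mul (by positivity),
      hyperbolicPoissonKernelGradient, inner_smul_left, abs_mul, Nat.add_sub_cancel, conj_trivial,
      abs_of_nonneg (by positivity)]
    congr 1
    ring
  rw [lintegral_congr hpt, lintegral_const_mul' _ _ ENNReal.ofReal_ne_top, sphereMeasure,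
    lintegral_smul_measure, inv, ← lintegral_smul_measure, ← sphereMeasure,
    lintegral_abs_inner_sphereMeasure hl, ← ENNReal.ofReal_mul (by positivity)]
  congr 1
  rw [hyperbolicGradientBound]
  push_cast
  ring

lemma hyperbolicGradientBound_pos (hn : 2 ≤ n) {x : EuclideanSpace ℝ (Fin n)} (hx : ‖x‖ < 1) :
    0 < hyperbolicGradientBound n x := by
  have h := one_sub_norm_sq_pos hx
  have hn' : (2 : ℝ) ≤ n := by exact_mod_cast hn
  have h1 : 0 < (n : ℝ) - 1 := by linarith
  have h2 : 0 < Real.Gamma ((n : ℝ) / 2) := Real.Gamma_pos_of_pos (by linarith)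
  have h3 : 0 < Real.Gamma (((n : ℝ) + 1) / 2) := Real.Gamma_pos_of_pos (by linarith)
  have h4 : 0 < √Real.pi := Real.sqrt_pos.2 Real.pi_pos
  rw [hyperbolicGradientBound]
  positivity

lemma integrable_inner_hyperbolicPoissonKernelGradient {x : EuclideanSpace ℝ (Fin n)}
    (hx : ‖x‖ < 1) (l : EuclideanSpace ℝ (Fin n)) :
    Integrable (fun ζ : sphere (0 : EuclideanSpace ℝ (Fin n)) 1 ↦
      inner ℝ (hyperbolicPoissonKernelGradient n x ζ.1) l) (sphereMeasure n) := by
  have := integrable_smul_hyperbolicPoissonKernelGradient (n := n) hx (φ := fun _ ↦ 1) (C := 1)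
    (by fun_prop) (by simp)
  simpa using this.inner_const l

lemma integral_abs_inner_hyperbolicPoissonKernelGradient (hn : 2 ≤ n)
    {x l : EuclideanSpace ℝ (Fin n)} (hx : ‖x‖ < 1) (hl : ‖l‖ = 1) :
    ∫ ζ, |inner ℝ (hyperbolicPoissonKernelGradient n x ζ.1) l| ∂(sphereMeasure n) =
      hyperbolicGradientBound n x := by
  rw [integral_eq_lintegral_of_nonneg_ae (.of_forall fun _ ↦ abs_nonneg _)
    (integrable_inner_hyperbolicPoissonKernelGradient hx l).abs.aestronglyMeasurable,
    lintegral_abs_inner_hyperbolicPoissonKernelGradient hx hl,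
    ENNReal.toReal_ofReal (hyperbolicGradientBound_pos hn hx).le]

lemma abs_inner_gradient_hyperbolicPoisson_le (hn : 2 ≤ n) {x l : EuclideanSpace ℝ (Fin n)}
    (hx : ‖x‖ < 1) (hl : ‖l‖ = 1) (φ : Lp ℝ ∞ (sphereMeasure n)) :
    |inner ℝ (gradient (hyperbolicPoisson n φ) x) l| ≤ hyperbolicGradientBound n x * ‖φ‖ := by
  rw [inner_gradient_hyperbolicPoisson hx, ← integral_abs_inner_hyperbolicPoissonKernelGradient hn
    hx hl, mul_comm, ← integral_const_mul, ← Real.norm_eq_abs]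
  refine norm_integral_le_of_norm_le
    ((integrable_inner_hyperbolicPoissonKernelGradient hx l).abs.const_mul _) ?_
  filter_upwards [ae_norm_le_norm_Lp_top φ] with ζ hζ
  rw [norm_mul, Real.norm_eq_abs (inner ℝ _ _)]
  gcongr

lemma norm_gradient_hyperbolicPoisson_le (hn : 2 ≤ n) {x : EuclideanSpace ℝ (Fin n)}
    (hx : ‖x‖ < 1) (φ : Lp ℝ ∞ (sphereMeasure n)) :
    ‖gradient (hyperbolicPoisson n φ) x‖ ≤ hyperbolicGradientBound n x * ‖φ‖ := by
  set g := gradient (hyperbolicPoisson n φ) x with hg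
  rcases eq_or_ne g 0 with h0 | h0
  · rw [h0, norm_zero]
    exact mul_nonneg (hyperbolicGradientBound_pos hn hx).le (norm_nonneg _)
  have hg0 : ‖g‖ ≠ 0 := norm_ne_zero_iff.2 h0
  -- The directional bound is tested in the direction of the gradient itself.
  have := abs_inner_gradient_hyperbolicPoisson_le hn hx
    (l := ‖g‖⁻¹ • g) (by rw [norm_smul, norm_inv, norm_norm, inv_mul_cancel₀ hg0]) φ
  rwa [← hg, inner_smul_right, real_inner_self_eq_norm_sq, pow_two, inv_mul_cancel_left₀ hg0,
    abs_norm] at this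

/-- The sign of `⟨∇ₓ K(x, ζ), l⟩` is an extremal boundary function. -/
lemma exists_inner_gradient_hyperbolicPoisson_eq (hn : 2 ≤ n) {x l : EuclideanSpace ℝ (Fin n)}
    (hx : ‖x‖ < 1) (hl : ‖l‖ = 1) : ∃ φ : Lp ℝ ∞ (sphereMeasure n), ‖φ‖ ≤ 1 ∧
      inner ℝ (gradient (hyperbolicPoisson n φ) x) l = hyperbolicGradientBound n x := by
  set g : sphere (0 : EuclideanSpace ℝ (Fin n)) 1 → ℝ :=
    fun ζ ↦ inner ℝ (hyperbolicPoissonKernelGradient n x ζ.1) l with hg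
  set φ₀ : sphere (0 : EuclideanSpace ℝ (Fin n)) 1 → ℝ :=
    fun ζ ↦ if 0 ≤ g ζ then 1 else -1 with hφ₀
  have hgm : Measurable g := by fun_prop
  have hφm : Measurable φ₀ :=
    Measurable.ite (measurableSet_le measurable_const hgm) measurable_const measurable_const
  have hb : ∀ ζ, ‖φ₀ ζ‖ ≤ 1 := fun ζ ↦ by
    simp only [hφ₀]
    split_ifs <;> simp
  have hL : MemLp φ₀ ∞ (sphereMeasure n) :=
    memLp_top_of_bound hφm.aestronglyMeasurable 1 (.of_forall hb)
  refine ⟨hL.toLp φ₀, ?_, ?_⟩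
  · have := Lp.norm_le_of_ae_bound (f := hL.toLp φ₀) zero_le_one
      (hL.coeFn_toLp.mono fun ζ hζ ↦ hζ ▸ hb ζ)
    simpa using this
  · rw [inner_gradient_hyperbolicPoisson hx,
      ← integral_abs_inner_hyperbolicPoissonKernelGradient hn hx hl]
    refine integral_congr_ae (hL.coeFn_toLp.mono fun ζ hζ ↦ ?_)
    simp only [hζ]
    change φ₀ ζ * g ζ = |g ζ|
    simp only [hφ₀]
    split_ifs with h
    · rw [one_mul, abs_of_nonneg h]
    · rw [neg_one_mul, abs_of_neg (not_le.1 h)]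

lemma hyperbolicGradientBound_le_of_forall (hn : 2 ≤ n) {x l : EuclideanSpace ℝ (Fin n)}
    (hx : ‖x‖ < 1) (hl : ‖l‖ = 1) {c : ℝ}
    (hc : ∀ φ : Lp ℝ ∞ (sphereMeasure n),
      |inner ℝ (gradient (hyperbolicPoisson n φ) x) l| ≤ c * ‖φ‖) :
    hyperbolicGradientBound n x ≤ c := by
  obtain ⟨φ, hφ, h⟩ := exists_inner_gradient_hyperbolicPoisson_eq hn hx hl
  have hpos := hyperbolicGradientBound_pos hn hx
  have h1 := hc φ
  rw [h, abs_of_pos hpos] at h1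
  -- The extremal function is only known to have norm at most `1`, so the sign of `c` is needed to
  -- pass from `c * ‖φ‖` to `c`.
  have hc0 : 0 ≤ c := by
    by_contra! h
    nlinarith [norm_nonneg φ]
  nlinarith

end Gradient

theorem mainTheorem4 (n : ℕ) (hn : 2 ≤ n) (x : EuclideanSpace ℝ (Fin n))
    (hx : x ∈ ball (0 : EuclideanSpace ℝ (Fin n)) 1) :
    (∀ φ : Lp ℝ ∞ (sphereMeasure n),
      DifferentiableAt ℝ (hyperbolicPoisson n φ) x ∧
      ‖gradient (hyperbolicPoisson n φ) x‖ ≤ hyperbolicGradientBound n x * ‖φ‖) ∧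
    IsOptimalGradientConstant n ∞ x (hyperbolicGradientBound n x) ∧
    ∀ ℓ : EuclideanSpace ℝ (Fin n), ‖ℓ‖ = 1 →
      IsOptimalDirectionalConstant n ∞ x ℓ (hyperbolicGradientBound n x) := by
  have hx' : ‖x‖ < 1 := mem_ball_zero_iff.1 hx
  refine ⟨fun φ ↦ ⟨(hasGradientAt_hyperbolicPoisson hx' (Lp.aestronglyMeasurable φ)
    (ae_norm_le_norm_Lp_top φ)).differentiableAt, norm_gradient_hyperbolicPoisson_le hn hx' φ⟩,
    ⟨norm_gradient_hyperbolicPoisson_le hn hx', fun c hc ↦ ?_⟩, fun l hl ↦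
    ⟨abs_inner_gradient_hyperbolicPoisson_le hn hx' hl, fun c hc ↦
      hyperbolicGradientBound_le_of_forall hn hx' hl hc⟩⟩
  -- Any unit vector serves here, as the directional constant does not depend on it.
  have hl : ‖EuclideanSpace.single (⟨0, by omega⟩ : Fin n) (1 : ℝ)‖ = 1 := by simp
  refine hyperbolicGradientBound_le_of_forall hn hx' hl fun φ ↦ le_trans ?_ (hc φ)
  simpa [hl] using abs_real_inner_le_norm (gradient (hyperbolicPoisson n φ) x)
    (EuclideanSpace.single (⟨0, by omega⟩ : Fin n) (1 : ℝ))
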